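/- Let $a,b\in\mathbb R$ and let $K$ be a nonnegative, piecewise continuous function on $[0,\infty)$ with $\int_0^\infty K(s)\,ds=1$ and $\int_0^\infty e^{\mu s}K(s)\,ds<\infty$ for some $\mu>0$. Let $X$ be the fundamental solution of $$x'(t)=a\,x(t)+b\int_0^\infty K(s)\,x(t-s)\,ds ,$$ that is, the solution for $t\ge 0$ with $X(0)=1$ and $X(t)=0$ for $t<0$. Let $h(\lambda)=\lambda-a-b\int_0^\infty e^{-\lambda s}K(s)\,ds$, defined for those $\lambda\in\mathbb C$ for which the integral converges absolutely (for all $\lambda\in\mathbb C$ if $b=0$). Let $\sigma\in[-\infty,\infty)$ be the infimum of the real parts of the points of this domain, and let $\alpha_0=\sup\{\mathrm{Re}\,\lambda : h(\lambda)=0\}$, the supremum being taken over the domain of $h$, with $\alpha_0=-\infty$ if $h$ has no root there. (If $h$ has a root, then $\sigma\le\alpha_0$.) Then $\alpha_0<+\infty$, and: 1. for every real $\alpha>\max\{\alpha_0,\sigma\}$ (that is, for every $\alpha>\alpha_0$ if $h$ has a root) there is a constant $C_1=C_1(\alpha)>0$ such that $|X(t)|\le C_1e^{\alpha t}$ for all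 $t\ge 0$; 2. for every real $\alpha_1<\alpha_0$ there are $\bar\alpha\in(\alpha_1,\alpha_0)$ and a measurable set $U\subset(0,\infty)$ of infinite Lebesgue measure such that $|X(t)|\ge e^{\bar\alpha t}$ for all $t\in U$. -/

import Mathlib

open Set MeasureTheory Filter Topology

noncomputable section

namespace DistributedDelay

/-- `f` is piecewise continuous on `[0, ∞)`: every bounded interval contains only finitely many
points of a set `S` off which `f` is continuous, and `f` has finite one-sided limits everywhere. -/
def PiecewiseContinuous (f : ℝ → ℝ) : Prop :=
  (∃ S : Set ℝ, (∀ T : ℝ, (S ∩ Icc 0 T).Finite) ∧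
    ∀ s ∈ Ici (0 : ℝ) \ S, ContinuousWithinAt f (Ici 0) s) ∧
  (∀ s : ℝ, 0 ≤ s → ∃ l : ℝ, Tendsto f (𝓝[>] s) (𝓝 l)) ∧
  (∀ s : ℝ, 0 < s → ∃ l : ℝ, Tendsto f (𝓝[<] s) (𝓝 l))

/-- A delay kernel: a nonnegative piecewise continuous probability density on `[0, ∞)` with a
finite exponential moment. (Values of `K` at negative arguments play no role anywhere.) -/
structure IsDelayKernel (K : ℝ → ℝ) : Prop where
  nonneg : ∀ s, 0 ≤ s → 0 ≤ K s
  piecewiseContinuous : PiecewiseContinuous K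
  integrable : IntegrableOn K (Ioi 0)
  integral_eq_one : ∫ s in Ioi (0 : ℝ), K s = 1
  exp_moment : ∃ μ : ℝ, 0 < μ ∧ IntegrableOn (fun s => Real.exp (μ * s) * K s) (Ioi 0)

/-- The fundamental solution of `x'(t) = a x(t) + b ∫₀^∞ K(s) x(t - s) ds`: the solution on
`[0, ∞)` with initial condition `X(0) = 1` and `X(t) = 0` for `t < 0`. The derivative is two-sided
for `t > 0` and the right derivative at `t = 0`, where `X` jumps. -/
structure IsFundamentalSolution (a b : ℝ) (K X : ℝ → ℝ) : Prop where
  eq_zero_of_neg : ∀ t, t < 0 → X t = 0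
  eq_one : X 0 = 1
  hasDeriv : ∀ t, 0 ≤ t →
    HasDerivWithinAt X (a * X t + b * ∫ s in Ioi (0 : ℝ), K s * X (t - s)) (Ici 0) t

/-- The Laplace transform `∫₀^∞ e^{-λ s} f(s) ds`. -/
def laplace (f : ℝ → ℝ) (z : ℂ) : ℂ :=
  ∫ s in Ioi (0 : ℝ), Complex.exp (-z * (s : ℂ)) * (f s : ℂ)

/-- The characteristic function `h(λ) = λ - a - b 𝓛(K)(λ)`; it is only meaningful on
`charDomain b K`. -/
def charFunction (a b : ℝ) (K : ℝ → ℝ) (z : ℂ) : ℂ :=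
  z - (a : ℂ) - (b : ℂ) * laplace K z

/-- The set of `λ` at which the delay term `b 𝓛(K)(λ)` of the characteristic function is given by
an absolutely convergent integral: all of `ℂ` if `b = 0`, and otherwise the set where `𝓛(K)(λ)`
converges absolutely. -/
def charDomain (b : ℝ) (K : ℝ → ℝ) : Set ℂ :=
  {z | IntegrableOn (fun s : ℝ => (b : ℂ) * (Complex.exp (-z * (s : ℂ)) * (K s : ℂ))) (Ioi 0)}

/-- The roots of the characteristic function, in the set where it is defined. -/
def charRoots (a b : ℝ) (K : ℝ → ℝ) : Set ℂ :=
  {z | z ∈ charDomain b K ∧ charFunction a b K z = 0}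

/-- `α₀`, the supremum of the real parts of the roots, as an extended real number
(`⊥` if there is no root). -/
def alphaZero (a b : ℝ) (K : ℝ → ℝ) : EReal :=
  ⨆ z ∈ charRoots a b K, ((z.re : ℝ) : EReal)

/-- The abscissa bounding on the left the domain of the characteristic function, as an extended
real number. It is at most `-μ` for every admissible exponent `μ`, and at most `α₀` as soon as
there is a root. -/
def abscissa (b : ℝ) (K : ℝ → ℝ) : EReal :=
  ⨅ z ∈ charDomain b K, ((z.re : ℝ) : EReal)

end DistributedDelay

end

noncomputable section

namespace DistributedDelay

variable {a b : ℝ} {K X : ℝ → ℝ} {z w : ℂ}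

/-! ### The domain of the characteristic function -/

/-! The Laplace transform turns the equation into `h(z) * laplace X z = 1` wherever both transforms
converge absolutely (`charFunction_mul_laplace`); both estimates rest on this identity.

Lower bound: let `z` be a root, `α < Re z`, and suppose `|X(t)| ≥ e^{αt}` only on a set `V` of
finite measure. The weighted solution `e^{-rt} X(t)`, `r = Re z`, changes at a rate controlled by
its running maximum, so it cannot make a large excursion inside the short tail of `V`; hence it is
bounded (`exists_bound_of_volume_ne_top`). Then `e^{-zt} X(t)` is integrable, and the identity reads
`0 = 1`. No analyticity of `h` at `z` is needed, so roots on the boundary of the domain are covered.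

Upper bound: if `h` has no root with `Re w ≥ α`, then `1/h(w) - 1/(w - c)` decays quadratically on
vertical strips. Fourier inversion on a line far to the right represents `X(t) - e^{ct}`; shifting
the line to `Re w = α` and taking absolute values gives the bound. -/

lemma charFunction_eq (a b : ℝ) (K : ℝ → ℝ) (z : ℂ) :
    charFunction a b K z = z - a -
      ∫ s in Ioi (0 : ℝ), (b : ℂ) * (Complex.exp (-z * (s : ℂ)) * (K s : ℂ)) := by
  rw [charFunction, laplace, integral_const_mul]

lemma norm_cexp_neg_mul (z : ℂ) (s : ℝ) :
    ‖Complex.exp (-z * (s : ℂ))‖ = Real.exp (-z.re * s) := by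
  simp [Complex.norm_exp]

lemma norm_delay_integrand (hK : IsDelayKernel K) {s : ℝ} (hs : 0 ≤ s) (z : ℂ) :
    ‖(b : ℂ) * (Complex.exp (-z * (s : ℂ)) * (K s : ℂ))‖
      = |b| * (Real.exp (-z.re * s) * K s) := by
  rw [norm_mul, norm_mul, norm_cexp_neg_mul, Complex.norm_real, Complex.norm_real,
    Real.norm_eq_abs, Real.norm_eq_abs, abs_of_nonneg (hK.nonneg s hs)]

lemma integrableOn_weight (hK : IsDelayKernel K) (hz : z ∈ charDomain b K) :
    IntegrableOn (fun s : ℝ => |b| * (Real.exp (-z.re * s) * K s)) (Ioi 0) :=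
  (Integrable.norm hz).congr <| (ae_restrict_iff' measurableSet_Ioi).2 <|
    ae_of_all _ fun _ hs => norm_delay_integrand hK (le_of_lt hs) z

lemma aestronglyMeasurable_delay_integrand (hK : IsDelayKernel K) (z : ℂ) :
    AEStronglyMeasurable (fun s : ℝ => (b : ℂ) * (Complex.exp (-z * (s : ℂ)) * (K s : ℂ)))
      (volume.restrict (Ioi 0)) := by
  have h1 : AEStronglyMeasurable (fun s : ℝ => (K s : ℂ)) (volume.restrict (Ioi 0)) :=
    Complex.continuous_ofReal.comp_aestronglyMeasurable hK.integrable.aestronglyMeasurable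
  have h2 : Continuous fun s : ℝ => Complex.exp (-z * (s : ℂ)) := by fun_prop
  exact (h2.aestronglyMeasurable.mul h1).const_mul _

lemma mem_charDomain_of_re_le (hK : IsDelayKernel K) (hz : z ∈ charDomain b K)
    (h : z.re ≤ w.re) : w ∈ charDomain b K := by
  refine Integrable.mono' (integrableOn_weight hK hz)
    (aestronglyMeasurable_delay_integrand hK w) ?_
  refine (ae_restrict_iff' measurableSet_Ioi).2 (ae_of_all _ fun s (hs : 0 < s) => ?_)
  rw [norm_delay_integrand hK hs.le]
  have := hK.nonneg s hs.le
  gcongr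

lemma mem_charDomain_of_nonneg (hK : IsDelayKernel K) (hz : 0 ≤ z.re) : z ∈ charDomain b K := by
  refine mem_charDomain_of_re_le (z := 0) hK ?_ (by simpa using hz)
  have := (hK.integrable.ofReal (𝕜 := ℂ)).const_mul (b : ℂ)
  simpa [charDomain, IntegrableOn] using this

/-- The total weighted mass of the delay term. -/
def delayMass (b : ℝ) (K : ℝ → ℝ) (r : ℝ) : ℝ :=
  ∫ s in Ioi (0 : ℝ), |b| * (Real.exp (-r * s) * K s)

lemma delayMass_nonneg (hK : IsDelayKernel K) (r : ℝ) : 0 ≤ delayMass b K r :=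
  setIntegral_nonneg measurableSet_Ioi fun s (hs : 0 < s) => by
    have := hK.nonneg s hs.le
    positivity

lemma delayMass_anti (hK : IsDelayKernel K) (hz : z ∈ charDomain b K) {r : ℝ} (h : z.re ≤ r) :
    delayMass b K r ≤ delayMass b K z.re := by
  have hr : (r : ℂ) ∈ charDomain b K := mem_charDomain_of_re_le hK hz (by simpa using h)
  have := integrableOn_weight hK hr
  refine setIntegral_mono_on (by simpa using this) (integrableOn_weight hK hz)
    measurableSet_Ioi fun s (hs : 0 < s) => ?_
  have := hK.nonneg s hs.le
  gcongr

lemma delayMass_zero (hK : IsDelayKernel K) : delayMass b K 0 = |b| := by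
  simp [delayMass, integral_const_mul, hK.integral_eq_one]

lemma norm_charFunction_sub_le (hK : IsDelayKernel K) (hz : z ∈ charDomain b K) :
    ‖charFunction a b K z - (z - a)‖ ≤ delayMass b K z.re := by
  rw [charFunction_eq, sub_sub_cancel_left, norm_neg]
  refine norm_integral_le_of_norm_le (integrableOn_weight hK hz) ?_
  exact (ae_restrict_iff' measurableSet_Ioi).2 <|
    ae_of_all _ fun s hs => (norm_delay_integrand hK (le_of_lt hs) z).le

/-- A root with `Re z ≥ 0` satisfies `|z - a| ≤ |b|`, because the delay mass decreases from its
value `|b|` at `0`. -/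
lemma re_le_of_mem_charRoots (hK : IsDelayKernel K) (hz : z ∈ charRoots a b K) :
    z.re ≤ |a| + |b| := by
  rcases le_total z.re 0 with h | h
  · exact h.trans (by positivity)
  have h0 : (0 : ℂ) ∈ charDomain b K := mem_charDomain_of_nonneg hK le_rfl
  have h1 := norm_charFunction_sub_le (a := a) hK hz.1
  have h2 := delayMass_anti hK h0 (r := z.re) (by simpa using h)
  rw [hz.2, zero_sub, norm_neg] at h1
  rw [Complex.zero_re, delayMass_zero hK] at h2
  have h3 := (abs_le.1 (Complex.abs_re_le_norm (z - a))).2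
  simp only [Complex.sub_re, Complex.ofReal_re] at h3
  linarith [le_abs_self a]

lemma alphaZero_lt_top (hK : IsDelayKernel K) : alphaZero a b K < ⊤ := by
  have h : alphaZero a b K ≤ ((|a| + |b| : ℝ) : EReal) := by
    refine iSup₂_le fun z hz => ?_
    have := re_le_of_mem_charRoots hK hz
    exact_mod_cast this
  exact h.trans_lt (EReal.coe_lt_top _)

/-! ### Elementary properties of the fundamental solution -/

namespace IsFundamentalSolution

lemma hasDerivAt (hX : IsFundamentalSolution a b K X) {t : ℝ} (ht : 0 < t) :
    HasDerivAt X (a * X t + b * ∫ s in Ioi (0 : ℝ), K s * X (t - s)) t :=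
  (hX.hasDeriv t ht.le).hasDerivAt (Ici_mem_nhds ht)

lemma continuousOn (hX : IsFundamentalSolution a b K X) : ContinuousOn X (Ici 0) := fun t ht =>
  (hX.hasDeriv t ht).continuousWithinAt

lemma measurable (hX : IsFundamentalSolution a b K X) : Measurable X := by
  refine measurable_of_continuousOn_compl_singleton 0 fun t ht => ?_
  rcases lt_or_gt_of_ne ht with h | h
  · refine ContinuousAt.continuousWithinAt ?_
    refine (continuousAt_const (y := (0 : ℝ))).congr ?_
    filter_upwards [Iio_mem_nhds h] with s hs using (hX.eq_zero_of_neg s hs).symm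
  · exact (hX.hasDerivAt h).continuousAt.continuousWithinAt

/-- Factoring `e^{r(t-s)} = e^{-rs} e^{rt}` makes the delay cost exactly the factor `delayMass b K
r`; the history before time `0` contributes nothing. This drives every growth estimate below. -/
lemma abs_rhs_le (hX : IsFundamentalSolution a b K X)
    (hK : IsDelayKernel K) {r M t : ℝ} (hr : (r : ℂ) ∈ charDomain b K)
    (ht : 0 ≤ t) (hM : ∀ s ∈ Icc 0 t, |X s| ≤ M * Real.exp (r * s)) :
    |a * X t + b * ∫ s in Ioi (0 : ℝ), K s * X (t - s)|
      ≤ (|a| + delayMass b K r) * M * Real.exp (r * t) := by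
  have hM0 : 0 ≤ M := by
    have := (abs_nonneg _).trans (hM 0 ⟨le_rfl, ht⟩)
    simpa using this
  have h1 : |a * X t| ≤ |a| * (M * Real.exp (r * t)) := by
    rw [abs_mul]
    exact mul_le_mul_of_nonneg_left (hM t ⟨ht, le_rfl⟩) (abs_nonneg a)
  have h2 : |b * ∫ s in Ioi (0 : ℝ), K s * X (t - s)|
      ≤ delayMass b K r * (M * Real.exp (r * t)) := by
    rw [← integral_const_mul, delayMass, ← integral_mul_const, ← Real.norm_eq_abs]
    have hi := integrableOn_weight hK hr
    rw [Complex.ofReal_re] at hi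
    refine norm_integral_le_of_norm_le (hi.mul_const _) ?_
    refine (ae_restrict_iff' measurableSet_Ioi).2 (ae_of_all _ fun s (hs : 0 < s) => ?_)
    have hKs := hK.nonneg s hs.le
    have h3 : |X (t - s)| ≤ M * Real.exp (r * (t - s)) := by
      rcases lt_or_ge t s with h | h
      · rw [hX.eq_zero_of_neg _ (by linarith), abs_zero]
        positivity
      · exact hM _ ⟨by linarith, by linarith⟩
    have h4 : Real.exp (r * (t - s)) = Real.exp (-r * s) * Real.exp (r * t) := by
      rw [← Real.exp_add]; ring_nf
    rw [h4] at h3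
    rw [Real.norm_eq_abs, abs_mul, abs_mul, abs_of_nonneg hKs]
    calc |b| * (K s * |X (t - s)|)
        ≤ |b| * (K s * (M * (Real.exp (-r * s) * Real.exp (r * t)))) := by gcongr
      _ = _ := by ring
  calc _ ≤ _ := abs_add_le _ _
    _ ≤ |a| * (M * Real.exp (r * t)) + delayMass b K r * (M * Real.exp (r * t)) :=
        add_le_add h1 h2
    _ = _ := by ring

/-- A maximum of the weighted solution on a compact interval. -/
lemma exists_max (hX : IsFundamentalSolution a b K X) (r : ℝ) {T : ℝ} (hT : 0 ≤ T) :
    ∃ t₀ ∈ Icc 0 T, ∀ t ∈ Icc 0 T,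
      |X t| ≤ |Real.exp (-r * t₀) * X t₀| * Real.exp (r * t) := by
  have hc : ContinuousOn (fun t => |Real.exp (-r * t) * X t|) (Icc 0 T) :=
    (ContinuousOn.mul (by fun_prop) (hX.continuousOn.mono Icc_subset_Ici_self)).abs
  obtain ⟨t₀, ht₀, h⟩ := isCompact_Icc.exists_isMaxOn (nonempty_Icc.2 hT) hc
  refine ⟨t₀, ht₀, fun t ht => ?_⟩
  have h1 : |Real.exp (-r * t) * X t| ≤ |Real.exp (-r * t₀) * X t₀| := h ht
  have h2 : |X t| = |Real.exp (-r * t) * X t| * Real.exp (r * t) := by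
    rw [abs_mul, Real.abs_exp, mul_right_comm, ← Real.exp_add]
    simp
  rw [h2]
  gcongr

/-- The rate `γ` is chosen so that `|a| + |b| ≤ γ/2`. If `M` is the maximum of `e^{-γt}|X(t)|` on
`[0, T]`, integrating the equation recovers only `M/2` plus the effect of the initial value, so `M ≤
2` whatever `T` is. -/
lemma exists_exp_bound (hX : IsFundamentalSolution a b K X) (hK : IsDelayKernel K) :
    ∀ t, 0 ≤ t → |X t| ≤ 2 * Real.exp ((2 * (|a| + |b|) + 1) * t) := by
  set γ := 2 * (|a| + |b|) + 1 with hγ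
  have hγ0 : 0 < γ := by positivity
  have hdom : (γ : ℂ) ∈ charDomain b K := mem_charDomain_of_nonneg hK (by simpa using hγ0.le)
  have hmass : delayMass b K γ ≤ |b| := by
    have := delayMass_anti hK (mem_charDomain_of_nonneg (z := 0) (b := b) hK le_rfl) (r := γ)
      (by simpa using hγ0.le)
    rwa [Complex.zero_re, delayMass_zero hK] at this
  intro T hT
  obtain ⟨t₀, ht₀, hM⟩ := hX.exists_max γ hT
  set M := |Real.exp (-γ * t₀) * X t₀| with hMdef
  have hM0 : 0 ≤ M := abs_nonneg _
  have key : |X t₀| ≤ 1 + M / 2 * Real.exp (γ * t₀) - M / 2 := by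
    -- The barrier starts at `1 = X(0)`, and its derivative `(γ/2) M e^{γt}` dominates `|X'|`.
    have := image_norm_le_of_norm_deriv_right_le_deriv_boundary (f := X) (a := 0) (b := T)
      (f' := fun t => a * X t + b * ∫ s in Ioi (0 : ℝ), K s * X (t - s))
      (B := fun t => 1 + M / 2 * Real.exp (γ * t) - M / 2)
      (B' := fun t => M / 2 * (Real.exp (γ * t) * γ))
      (hX.continuousOn.mono Icc_subset_Ici_self)
      (fun t ht => (hX.hasDeriv t ht.1).mono (Ici_subset_Ici.2 ht.1))
      (by simp [hX.eq_one])
      (fun t => by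
        have h1 : HasDerivAt (fun t : ℝ => γ * t) γ t := by
          simpa using (hasDerivAt_id t).const_mul γ
        exact ((h1.exp.const_mul (M / 2)).const_add 1).sub_const _)
      (fun t ht => by
        rw [Real.norm_eq_abs]
        refine (hX.abs_rhs_le hK hdom ht.1
          fun s hs => hM s ⟨hs.1, hs.2.trans ht.2.le⟩).trans ?_
        have h1 : |a| + delayMass b K γ ≤ γ / 2 := by rw [hγ]; linarith
        calc _ ≤ γ / 2 * M * Real.exp (γ * t) := by gcongr
          _ = _ := by ring)
      ht₀
    simpa using this
  have hM2 : M ≤ 2 := by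
    have h1 : M = Real.exp (-γ * t₀) * |X t₀| := by rw [hMdef, abs_mul, Real.abs_exp]
    have h2 : Real.exp (-γ * t₀) * Real.exp (γ * t₀) = 1 := by
      rw [← Real.exp_add]; simp
    have h3 : Real.exp (-γ * t₀) ≤ 1 := Real.exp_le_one_iff.2 (by nlinarith [ht₀.1])
    have h4 := Real.exp_pos (-γ * t₀)
    have h5 : M ≤ Real.exp (-γ * t₀) * (1 + M / 2 * Real.exp (γ * t₀) - M / 2) := by
      rw [h1]; exact mul_le_mul_of_nonneg_left (h1 ▸ key) h4.le
    have h6 : Real.exp (-γ * t₀) * (1 + M / 2 * Real.exp (γ * t₀) - M / 2)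
        = Real.exp (-γ * t₀) * (1 - M / 2) + M / 2 := by linear_combination M / 2 * h2
    by_contra! hlt
    nlinarith
  exact (hM T ⟨hT, le_rfl⟩).trans (by gcongr)

lemma aestronglyMeasurable_transform (hX : IsFundamentalSolution a b K X) (z : ℂ) :
    AEStronglyMeasurable (fun t : ℝ => Complex.exp (-z * (t : ℂ)) * (X t : ℂ)) volume := by
  have h1 : Continuous fun s : ℝ => Complex.exp (-z * (s : ℂ)) := by fun_prop
  exact (h1.measurable.mul (Complex.measurable_ofReal.comp hX.measurable)).aestronglyMeasurable

/-- Wherever both Laplace transforms converge absolutely, that of the fundamental solution is the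
inverse of the characteristic function. -/
lemma charFunction_mul_laplace (hX : IsFundamentalSolution a b K X) (hz : z ∈ charDomain b K)
    (hi : IntegrableOn (fun t : ℝ => Complex.exp (-z * (t : ℂ)) * (X t : ℂ)) (Ioi 0)) :
    charFunction a b K z * laplace X z = 1 := by
  set y : ℝ → ℂ := fun t => Complex.exp (-z * (t : ℂ)) * (X t : ℂ) with hy
  -- Extended by zero, the weighted kernel and solution have as convolution the weighted delay term,
  -- whose integral therefore factors.
  set k : ℝ → ℂ := (Ioi 0).indicator
    (fun s => (b : ℂ) * (Complex.exp (-z * (s : ℂ)) * (K s : ℂ))) with hk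
  set v : ℝ → ℂ := (Ioi 0).indicator y with hv
  have hki : Integrable k := (integrable_indicator_iff measurableSet_Ioi).2 hz
  have hvi : Integrable v := (integrable_indicator_iff measurableSet_Ioi).2 hi
  set c : ℝ → ℂ := convolution k v (ContinuousLinearMap.mul ℂ ℂ) volume with hc
  have hci : Integrable c := hki.integrable_convolution _ hvi
  have hcint : ∫ t, c t = (∫ s, k s) * ∫ t, v t :=
    integral_convolution (ContinuousLinearMap.mul ℂ ℂ) hki hvi
  have hcneg : ∀ t ∉ Ioi (0 : ℝ), c t = 0 := by
    intro t ht
    rw [hc, convolution_def]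
    refine integral_eq_zero_of_ae (ae_of_all _ fun s => ?_)
    by_cases hs : s ∈ Ioi (0 : ℝ)
    · have : t - s ∉ Ioi (0 : ℝ) := by
        simp only [mem_Ioi, not_lt] at *; linarith
      simp [hv, this]
    · simp [hk, hs]
  have hcpos : ∀ t ∈ Ioi (0 : ℝ), c t = Complex.exp (-z * (t : ℂ)) *
      ((b * ∫ s in Ioi (0 : ℝ), K s * X (t - s) : ℝ) : ℂ) := by
    intro t _
    rw [hc, convolution_def, Complex.ofReal_mul, ← integral_complex_ofReal,
      ← integral_const_mul, ← integral_const_mul, ← integral_indicator measurableSet_Ioi]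
    refine integral_congr_ae ?_
    -- At `s = t` the integrands may differ, since `X 0 = 1` while the indicator of the open
    -- half-line vanishes at `0`.
    have hne : ∀ᵐ s : ℝ, s ≠ t := by
      simp [ae_iff]
    filter_upwards [hne] with s hst
    by_cases hs : s ∈ Ioi (0 : ℝ)
    · simp only [hk, hs, indicator_of_mem, ContinuousLinearMap.mul_apply', hv]
      have hv' : (Ioi (0 : ℝ)).indicator y (t - s) = y (t - s) := by
        rw [indicator_apply_eq_self]
        intro h
        have : t - s < 0 := lt_of_le_of_ne (not_lt.1 h) (sub_ne_zero.2 hst.symm)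
        simp [hy, hX.eq_zero_of_neg _ this]
      rw [hv', hy]
      have : Complex.exp (-z * (t : ℂ))
          = Complex.exp (-z * (s : ℂ)) * Complex.exp (-z * ((t - s : ℝ) : ℂ)) := by
        rw [← Complex.exp_add]; push_cast; ring_nf
      rw [this]
      push_cast
      ring
    · simp [hk, hs]
  have hderiv : ∀ t ∈ Ioi (0 : ℝ), HasDerivAt y ((a - z) * y t + c t) t := by
    intro t ht
    have h1 : HasDerivAt (fun t : ℝ => -z * (t : ℂ)) (-z) t := by
      simpa using (Complex.ofRealCLM.hasDerivAt (x := t)).const_mul (-z)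
    have h2 := h1.cexp.mul (hX.hasDerivAt ht).ofReal_comp
    refine h2.congr_deriv ?_
    rw [hcpos t ht, hy]
    push_cast
    ring
  have hdi : IntegrableOn (fun t => ((a : ℂ) - z) * y t + c t) (Ioi 0) :=
    (hi.const_mul _).add hci.integrableOn
  have hlim := tendsto_zero_of_hasDerivAt_of_integrableOn_Ioi hderiv hdi hi
  have hcont : ContinuousWithinAt y (Ici 0) 0 := by
    have h1 : Continuous fun s : ℝ => Complex.exp (-z * (s : ℂ)) := by fun_prop
    exact h1.continuousWithinAt.mul
      (Complex.continuous_ofReal.continuousAt.comp_continuousWithinAt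
        (hX.continuousOn 0 self_mem_Ici))
  -- Since `y` tends to `0` at infinity, its derivative integrates to `-y 0 = -1`.
  have hint := integral_Ioi_of_hasDerivAt_of_tendsto hcont hderiv hdi hlim
  have hy0 : y 0 = 1 := by simp [hy, hX.eq_one]
  rw [integral_add (hi.const_mul _) hci.integrableOn, integral_const_mul,
    setIntegral_eq_integral_of_forall_compl_eq_zero hcneg, hcint, hk, hv,
    integral_indicator measurableSet_Ioi, integral_indicator measurableSet_Ioi, hy0] at hint
  rw [charFunction_eq, laplace]
  linear_combination -hint

end IsFundamentalSolution

/-! ### Exponential lower bounds -/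

lemma exists_volume_inter_Ioi_lt {V : Set ℝ} (hV : MeasurableSet V) (hfin : volume V ≠ ⊤)
    {ε : ENNReal} (hε : 0 < ε) : ∃ T : ℝ, 0 ≤ T ∧ volume (V ∩ Ioi T) < ε := by
  have h := tendsto_measure_iInter_atTop (μ := volume) (s := fun T : ℝ => V ∩ Ioi T)
    (fun T => (hV.inter measurableSet_Ioi).nullMeasurableSet)
    (fun s t hst => inter_subset_inter_right _ (Ioi_subset_Ioi hst))
    ⟨0, measure_ne_top_of_subset inter_subset_left hfin⟩
  have h0 : (⋂ T : ℝ, V ∩ Ioi T) = ∅ := by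
    ext x
    simp only [mem_iInter, mem_inter_iff, mem_Ioi, mem_empty_iff_false, iff_false, not_forall]
    exact ⟨x, fun hx => lt_irrefl _ hx.2⟩
  rw [h0, measure_empty] at h
  obtain ⟨T, h1, h2⟩ := ((h.eventually_lt_const hε).and (eventually_ge_atTop 0)).exists
  exact ⟨T, h2, h1⟩

namespace IsFundamentalSolution

/-- If the fundamental solution is small outside a set of finite measure, then it is
bounded with a possibly larger exponential rate. -/
lemma exists_bound_of_volume_ne_top (hX : IsFundamentalSolution a b K X)
    (hK : IsDelayKernel K) {r : ℝ}
    (hr : (r : ℂ) ∈ charDomain b K) {V : Set ℝ} (hV : MeasurableSet V)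
    (hfin : volume V ≠ ⊤) (hsmall : ∀ t, 0 < t → t ∉ V → |X t| ≤ Real.exp (r * t)) :
    ∃ M, 0 ≤ M ∧ ∀ t, 0 ≤ t → |X t| ≤ M * Real.exp (r * t) := by
  -- If `M` is the running maximum of `|y|`, where `y t = e^{-rt} X t`, then `|y'| ≤ L * M`, so `y`
  -- moves by at most `M/2` over a time `1/(2L)`. The summand `1` keeps this window shorter than
  -- `1`.
  set L := |r| + (|a| + delayMass b K r) + 1 with hL
  have hL1 : 1 ≤ L := by
    have := delayMass_nonneg (b := b) hK r
    rw [hL]; linarith [abs_nonneg r, abs_nonneg a]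
  have hL0 : 0 < L := by linarith
  have hδ : 0 < 1 / (2 * L) := by positivity
  obtain ⟨T₀, hT₀, hVT⟩ := exists_volume_inter_Ioi_lt hV hfin (ENNReal.ofReal_pos.2 hδ)
  obtain ⟨s₀, -, hs₀⟩ := hX.exists_max r (T := T₀ + 1) (by linarith)
  set M₀ := |Real.exp (-r * s₀) * X s₀|
  refine ⟨max M₀ 2, le_max_of_le_right zero_le_two, fun T hT => ?_⟩
  obtain ⟨t₀, ht₀, hM⟩ := hX.exists_max r hT
  set y : ℝ → ℝ := fun t => Real.exp (-r * t) * X t with hy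
  have habs : ∀ (t B : ℝ), |X t| ≤ B * Real.exp (r * t) → |y t| ≤ B := by
    intro t B h
    have h2 : Real.exp (-r * t) * Real.exp (r * t) = 1 := by
      rw [← Real.exp_add]; simp
    rw [hy, abs_mul, Real.abs_exp]
    calc _ ≤ Real.exp (-r * t) * (B * Real.exp (r * t)) := by gcongr
      _ = B := by linear_combination B * h2
  set M := |y t₀| with hMdef
  change ∀ t ∈ Icc 0 T, |X t| ≤ M * Real.exp (r * t) at hM
  have hM0 : 0 ≤ M := abs_nonneg _
  suffices hle : M ≤ max M₀ 2 from (hM T ⟨hT, le_rfl⟩).trans (by gcongr)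
  rcases le_total t₀ (T₀ + 1) with h | h
  · exact le_max_of_le_left (habs _ _ (hs₀ t₀ ⟨ht₀.1, h⟩))
  refine le_max_of_le_right ?_
  have hδ1 : 1 / (2 * L) < 1 := by rw [div_lt_one (by positivity)]; linarith
  -- The window ending at the maximum point lies beyond `T₀`, where `V` has too little measure to
  -- cover it. At an uncovered point `|y| ≤ 1`, whence `M ≤ M/2 + 1`.
  obtain ⟨t, ht, htV⟩ : ∃ t ∈ Icc (t₀ - 1 / (2 * L)) t₀, t ∉ V := by
    by_contra! hcon
    have hsub : Icc (t₀ - 1 / (2 * L)) t₀ ⊆ V ∩ Ioi T₀ := fun t ht =>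
      ⟨hcon t ht, mem_Ioi.2 (by linarith [ht.1])⟩
    have := (measure_mono (μ := volume) hsub).trans_lt hVT
    rw [Real.volume_Icc, sub_sub_cancel] at this
    exact lt_irrefl _ this
  have ht0 : 0 < t := by linarith [ht.1]
  have hyt : |y t| ≤ 1 := habs t 1 (by simpa using hsmall t ht0 htV)
  have hdiff : |y t₀ - y t| ≤ L * M * |t₀ - t| := by
    have hderiv : ∀ s ∈ Icc t t₀, HasDerivWithinAt y
        (Real.exp (-r * s) * -r * X s + Real.exp (-r * s) *
          (a * X s + b * ∫ u in Ioi (0 : ℝ), K u * X (s - u))) (Icc t t₀) s := by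
      intro s hs
      have h1 : HasDerivAt (fun t : ℝ => -r * t) (-r) s := by
        simpa using (hasDerivAt_id s).const_mul (-r)
      exact (h1.exp.mul (hX.hasDerivAt (ht0.trans_le hs.1))).hasDerivWithinAt
    refine Convex.norm_image_sub_le_of_norm_hasDerivWithin_le hderiv (fun s hs => ?_)
      (convex_Icc _ _) ⟨le_rfl, ht.2⟩ ⟨ht.2, le_rfl⟩
    have hs0 : 0 ≤ s := ht0.le.trans hs.1
    have h1 := hX.abs_rhs_le hK hr hs0 fun u hu => hM u ⟨hu.1, (hu.2.trans hs.2).trans ht₀.2⟩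
    have h2 : |X s| ≤ M * Real.exp (r * s) := hM s ⟨hs0, hs.2.trans ht₀.2⟩
    have h3 : Real.exp (-r * s) * Real.exp (r * s) = 1 := by
      rw [← Real.exp_add]; simp
    rw [Real.norm_eq_abs]
    calc _ ≤ _ := abs_add_le _ _
      _ = Real.exp (-r * s) * |r| * |X s| + Real.exp (-r * s) *
          |a * X s + b * ∫ u in Ioi (0 : ℝ), K u * X (s - u)| := by
        rw [abs_mul, abs_mul, abs_mul, Real.abs_exp, abs_neg]
      _ ≤ Real.exp (-r * s) * |r| * (M * Real.exp (r * s)) + Real.exp (-r * s) *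
          ((|a| + delayMass b K r) * M * Real.exp (r * s)) := by gcongr
      _ = (|r| + (|a| + delayMass b K r)) * M := by
        linear_combination (|r| + (|a| + delayMass b K r)) * M * h3
      _ ≤ L * M := by gcongr; linarith
  have h1 : |t₀ - t| ≤ 1 / (2 * L) := by
    rw [abs_of_nonneg (by linarith [ht.2])]; linarith [ht.1]
  have h2 : L * M * |t₀ - t| ≤ M / 2 := by
    calc _ ≤ L * M * (1 / (2 * L)) := by gcongr
      _ = M / 2 := by field_simp
  have h3 : M ≤ |y t₀ - y t| + |y t| := by
    simpa using abs_add_le (y t₀ - y t) (y t)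
  linarith

/-- Were the measure finite, `e^{-zt} X(t)` would be dominated by a decaying exponential off the set
and by a constant on it, hence integrable, contradicting `h(z) * laplace X z = 1`. -/
lemma volume_eq_top_of_charRoot (hX : IsFundamentalSolution a b K X)
    (hK : IsDelayKernel K) (hz : z ∈ charRoots a b K) {α : ℝ}
    (hα : α < z.re) : volume {t : ℝ | 0 < t ∧ Real.exp (α * t) ≤ |X t|} = ⊤ := by
  by_contra hfin
  set V := {t : ℝ | 0 < t ∧ Real.exp (α * t) ≤ |X t|} with hVdef
  have hV : MeasurableSet V :=
    (measurableSet_lt measurable_const measurable_id).inter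
      (measurableSet_le (by fun_prop) hX.measurable.abs)
  have hsmall : ∀ t, 0 < t → t ∉ V → |X t| ≤ Real.exp (α * t) := by
    intro t ht htV
    by_contra! h
    exact htV ⟨ht, h.le⟩
  obtain ⟨M, hM0, hM⟩ := hX.exists_bound_of_volume_ne_top hK (r := z.re)
    (mem_charDomain_of_re_le hK hz.1 (by simp)) hV hfin
    fun t ht htV => (hsmall t ht htV).trans (by gcongr)
  have hi : IntegrableOn (fun t : ℝ => Complex.exp (-z * (t : ℂ)) * (X t : ℂ)) (Ioi 0) := by
    have h1 := integrableOn_exp_mul_Ioi (a := α - z.re) (by linarith) 0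
    have h2 : IntegrableOn (V.indicator fun _ => M) (Ioi 0) :=
      ((integrable_indicator_iff hV).2 (integrableOn_const hfin)).integrableOn
    refine Integrable.mono' (h1.add h2) (hX.aestronglyMeasurable_transform z).restrict ?_
    refine (ae_restrict_iff' measurableSet_Ioi).2 (ae_of_all _ fun t (ht : 0 < t) => ?_)
    rw [norm_mul, norm_cexp_neg_mul, Complex.norm_real, Real.norm_eq_abs, Pi.add_apply]
    by_cases htV : t ∈ V
    · rw [indicator_of_mem htV]
      have h3 : Real.exp (-z.re * t) * Real.exp (z.re * t) = 1 := by
        rw [← Real.exp_add]; simp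
      calc _ ≤ Real.exp (-z.re * t) * (M * Real.exp (z.re * t)) := by
            have := hM t ht.le
            gcongr
        _ = M := by linear_combination M * h3
        _ ≤ _ := by linarith [Real.exp_pos ((α - z.re) * t)]
    · rw [indicator_of_notMem htV, add_zero]
      calc _ ≤ Real.exp (-z.re * t) * Real.exp (α * t) := by
            have := hsmall t ht htV
            gcongr
        _ = _ := by rw [← Real.exp_add]; ring_nf
  have := hX.charFunction_mul_laplace hz.1 hi
  rw [hz.2, zero_mul] at this
  exact zero_ne_one this

end IsFundamentalSolution

/-! ### Exponential upper bounds -/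

/-- Shifting the line of integration of a holomorphic function with quadratic decay. -/
lemma integral_vertical_eq {F : ℂ → ℂ} {α γ C : ℝ} (hαγ : α ≤ γ)
    (hF : ∀ z : ℂ, z.re ∈ Icc α γ → DifferentiableAt ℂ F z)
    (hC : ∀ z : ℂ, z.re ∈ Icc α γ → ‖F z‖ ≤ C * (1 + z.im ^ 2)⁻¹) :
    ∫ y : ℝ, F (α + y * Complex.I) = ∫ y : ℝ, F (γ + y * Complex.I) := by
  have hint : ∀ c ∈ Icc α γ, Integrable fun y : ℝ => F (c + y * Complex.I) := by
    intro c hc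
    have hcont : Continuous fun y : ℝ => F (c + y * Complex.I) := by
      refine continuous_iff_continuousAt.2 fun y => ?_
      refine ContinuousAt.comp (f := fun y : ℝ => (c + y * Complex.I : ℂ)) (g := F) ?_
        (by fun_prop)
      exact (hF _ (by simpa using hc)).continuousAt
    refine (integrable_inv_one_add_sq.const_mul C).mono' hcont.aestronglyMeasurable
      (ae_of_all _ fun y => ?_)
    simpa using hC (c + y * Complex.I) (by simpa using hc)
  -- The horizontal sides of the rectangle; `u` is later taken to be `R` and `-R`.
  have hside : ∀ u : ℝ → ℝ, Tendsto (fun R => (u R) ^ 2) atTop atTop →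
      Tendsto (fun R : ℝ => ∫ x in α..γ, F (x + (u R : ℝ) * Complex.I)) atTop (𝓝 0) := by
    intro u hu
    have h1 : Tendsto (fun R : ℝ => C * (1 + (u R) ^ 2)⁻¹ * |γ - α|) atTop (𝓝 0) := by
      have := (tendsto_atTop_add_const_left _ (1 : ℝ) hu).inv_tendsto_atTop
      simpa using (this.const_mul C).mul_const |γ - α|
    refine squeeze_zero_norm (fun R => ?_) h1
    refine intervalIntegral.norm_integral_le_of_norm_le_const fun x hx => ?_
    rw [uIoc_of_le hαγ] at hx
    simpa using hC (x + (u R : ℝ) * Complex.I) (by simpa using Ioc_subset_Icc_self hx)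
  have hrect : ∀ R : ℝ, (((∫ x : ℝ in α..γ, F (x + ((-R : ℝ) : ℂ) * Complex.I))
      - ∫ x : ℝ in α..γ, F (x + (R : ℂ) * Complex.I))
      + Complex.I • ∫ y : ℝ in (-R)..R, F (γ + y * Complex.I))
      - Complex.I • ∫ y : ℝ in (-R)..R, F (α + y * Complex.I) = 0 := by
    intro R
    have := Complex.integral_boundary_rect_eq_zero_of_differentiableOn F ⟨α, -R⟩ ⟨γ, R⟩
      fun z hz => (hF z (by
        have := hz.1
        rwa [uIcc_of_le hαγ] at this)).differentiableWithinAt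
    simp only at this
    exact this
  have hlim : ∀ c ∈ Icc α γ, Tendsto (fun R : ℝ => ∫ y : ℝ in (-R)..R, F (c + y * Complex.I))
      atTop (𝓝 (∫ y : ℝ, F (c + y * Complex.I))) := fun c hc =>
    intervalIntegral_tendsto_integral (hint c hc) tendsto_neg_atTop_atBot tendsto_id
  have hsq : Tendsto (fun R : ℝ => R ^ 2) atTop atTop := tendsto_pow_atTop two_ne_zero
  have htot := (((hside (fun R => -R) (by simp [hsq])).sub (hside (fun R => R) hsq)).add
    ((hlim γ ⟨hαγ, le_rfl⟩).const_smul Complex.I)).sub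
    ((hlim α ⟨le_rfl, hαγ⟩).const_smul Complex.I)
  have hzero := tendsto_nhds_unique (htot.congr hrect) tendsto_const_nhds
  simp only [sub_self, zero_add, smul_eq_mul, ← mul_sub] at hzero
  have := (mul_eq_zero.1 hzero).resolve_left Complex.I_ne_zero
  exact (sub_eq_zero.1 this).symm

/-- Differentiating under the integral produces a factor `s`, absorbed by half of the gap `Re w - Re
z` through `δ s ≤ e^{δ s}`. -/
lemma differentiableAt_charFunction (hK : IsDelayKernel K) (hz : z ∈ charDomain b K)
    (h : z.re < w.re) : DifferentiableAt ℂ (charFunction a b K) w := by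
  set δ := (w.re - z.re) / 2 with hδ
  have hδ0 : 0 < δ := by rw [hδ]; linarith
  have hd := (hasDerivAt_integral_of_dominated_loc_of_deriv_le (𝕜 := ℂ)
    (μ := volume.restrict (Ioi (0 : ℝ))) (x₀ := w) (s := {u : ℂ | z.re + δ < u.re})
    (F := fun u s => (b : ℂ) * (Complex.exp (-u * (s : ℂ)) * (K s : ℂ)))
    (F' := fun u s => (b : ℂ) * (Complex.exp (-u * (s : ℂ)) * (-(s : ℂ)) * (K s : ℂ)))
    (bound := fun s => δ⁻¹ * (|b| * (Real.exp (-z.re * s) * K s)))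
    ((isOpen_lt continuous_const Complex.continuous_re).mem_nhds (by
      change z.re + δ < w.re; linarith))
    (Eventually.of_forall fun u => aestronglyMeasurable_delay_integrand hK u)
    (mem_charDomain_of_re_le hK hz h.le) ?_ ?_ ((integrableOn_weight hK hz).const_mul _)
    ?_).2
  · have : DifferentiableAt ℂ (fun u : ℂ => u - a -
        ∫ s in Ioi (0 : ℝ), (b : ℂ) * (Complex.exp (-u * (s : ℂ)) * (K s : ℂ))) w :=
      (differentiableAt_id.sub_const _).sub hd.differentiableAt
    exact this.congr_of_eventuallyEq (Eventually.of_forall (charFunction_eq a b K))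
  · have h1 : AEStronglyMeasurable (fun s : ℝ => (K s : ℂ)) (volume.restrict (Ioi 0)) :=
      Complex.continuous_ofReal.comp_aestronglyMeasurable hK.integrable.aestronglyMeasurable
    have h2 : Continuous fun s : ℝ => Complex.exp (-w * (s : ℂ)) * (-(s : ℂ)) := by fun_prop
    exact (h2.aestronglyMeasurable.mul h1).const_mul _
  · refine (ae_restrict_iff' measurableSet_Ioi).2 (ae_of_all _ fun s (hs : 0 < s) u hu => ?_)
    have hKs := hK.nonneg s hs.le
    rw [norm_mul, norm_mul, norm_mul, norm_cexp_neg_mul, Complex.norm_real, norm_neg,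
      Complex.norm_real, Complex.norm_real, Real.norm_eq_abs, Real.norm_eq_abs,
      Real.norm_eq_abs, abs_of_pos hs, abs_of_nonneg hKs]
    have h1 : Real.exp (-u.re * s) * s ≤ δ⁻¹ * Real.exp (-z.re * s) := by
      have h2 : δ * s ≤ Real.exp (δ * s) := by linarith [Real.add_one_le_exp (δ * s)]
      have h3 : Real.exp (-u.re * s) * Real.exp (δ * s) ≤ Real.exp (-z.re * s) := by
        rw [← Real.exp_add, Real.exp_le_exp]
        have : z.re + δ < u.re := hu
        nlinarith
      rw [inv_mul_eq_div, le_div_iff₀ hδ0]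
      calc _ = Real.exp (-u.re * s) * (δ * s) := by ring
        _ ≤ Real.exp (-u.re * s) * Real.exp (δ * s) := by gcongr
        _ ≤ _ := h3
    calc _ ≤ |b| * (δ⁻¹ * Real.exp (-z.re * s) * K s) := by gcongr
      _ = _ := by ring
  · refine ae_of_all _ fun s u _ => ?_
    have h1 : HasDerivAt (fun u : ℂ => -u * (s : ℂ)) (-(s : ℂ)) u := by
      simpa using (hasDerivAt_neg u).mul_const (s : ℂ)
    exact ((h1.cexp).mul_const _).const_mul _

/-- A lower bound for the characteristic function on a strip free of roots. -/
lemma exists_lower_bound_charFunction (hK : IsDelayKernel K) (hz : z ∈ charDomain b K)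
    {α γ c : ℝ} (hα : z.re < α) (hc : c < α)
    (hne : ∀ w : ℂ, w.re ∈ Icc α γ → charFunction a b K w ≠ 0) :
    ∃ m, 0 < m ∧ ∀ w : ℂ, w.re ∈ Icc α γ → m * ‖w - c‖ ≤ ‖charFunction a b K w‖ := by
  -- On the strip `|h(w) - (w - c)| ≤ B`, so `|h(w)| ≥ |w - c| / 2` once `|w - c| ≥ 2B`; the rest of
  -- the strip is compact.
  set B := |a - c| + delayMass b K z.re with hB
  have hB0 : 0 ≤ B := add_nonneg (abs_nonneg _) (delayMass_nonneg hK _)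
  set S := {w : ℂ | w.re ∈ Icc α γ} ∩ Metric.closedBall (c : ℂ) (2 * B) with hS
  have hScomp : IsCompact S :=
    (isCompact_closedBall _ _).inter_left (isClosed_Icc.preimage Complex.continuous_re)
  have hcne : ∀ w : ℂ, w.re ∈ Icc α γ → 0 < ‖w - c‖ := by
    intro w hw
    refine norm_pos_iff.2 (sub_ne_zero.2 fun h => ?_)
    rw [h] at hw
    have := hw.1
    simp only [Complex.ofReal_re] at this
    linarith
  have hfar : ∀ w : ℂ, w.re ∈ Icc α γ → 2 * B ≤ ‖w - c‖ →
      1 / 2 * ‖w - c‖ ≤ ‖charFunction a b K w‖ := by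
    intro w hw h
    have h1 := norm_charFunction_sub_le (a := a) hK
      (mem_charDomain_of_re_le hK hz (hα.le.trans hw.1))
    have h2 := delayMass_anti hK hz (hα.le.trans hw.1)
    have h3 : ‖w - c‖ ≤ ‖charFunction a b K w‖ + ‖charFunction a b K w - (w - a)‖
        + ‖((a - c : ℝ) : ℂ)‖ := by
      calc ‖w - c‖ = ‖charFunction a b K w - (charFunction a b K w - (w - a))
            + ((a - c : ℝ) : ℂ)‖ := by push_cast; ring_nf
        _ ≤ _ := (norm_add_le _ _).trans (by gcongr; exact norm_sub_le _ _)
    rw [Complex.norm_real, Real.norm_eq_abs] at h3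
    linarith
  have hcont : ContinuousOn (fun w : ℂ => ‖charFunction a b K w‖ / ‖w - c‖) S := by
    intro w hw
    have h1 := (differentiableAt_charFunction (a := a) hK hz
      (hα.trans_le hw.1.1)).continuousAt.norm
    have h2 : ContinuousAt (fun w : ℂ => ‖w - c‖) w := by fun_prop
    exact (h1.div h2 (hcne w hw.1).ne').continuousWithinAt
  obtain ⟨m, hm0, hm⟩ : ∃ m, 0 < m ∧ ∀ w ∈ S, m ≤ ‖charFunction a b K w‖ / ‖w - c‖ := by
    rcases S.eq_empty_or_nonempty with h | h
    · exact ⟨1, one_pos, by simp [h]⟩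
    · obtain ⟨w, hw, hmin⟩ := hScomp.exists_isMinOn h hcont
      exact ⟨_, div_pos (norm_pos_iff.2 (hne w hw.1)) (hcne w hw.1), fun v hv => hmin hv⟩
  refine ⟨min m (1 / 2), by positivity, fun w hw => ?_⟩
  rcases le_total ‖w - c‖ (2 * B) with h | h
  · have := hm w ⟨hw, by rwa [Metric.mem_closedBall, dist_eq_norm]⟩
    rw [le_div_iff₀ (hcne w hw)] at this
    exact (mul_le_mul_of_nonneg_right (min_le_left _ _) (norm_nonneg _)).trans this
  · exact (mul_le_mul_of_nonneg_right (min_le_right _ _) (norm_nonneg _)).trans (hfar w hw h)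

/-- On a strip free of roots, the inverse of the characteristic function differs from `(w - c)⁻¹`
by a quadratically decaying function. -/
lemma exists_bound_inv_charFunction_sub (hK : IsDelayKernel K) (hz : z ∈ charDomain b K)
    {α γ : ℝ} (hα : z.re < α)
    (hne : ∀ w : ℂ, w.re ∈ Icc α γ → charFunction a b K w ≠ 0) :
    ∃ C, 0 ≤ C ∧ ∀ w : ℂ, w.re ∈ Icc α γ →
      ‖(charFunction a b K w)⁻¹ - (w - ((α - 1 : ℝ) : ℂ))⁻¹‖ ≤ C * (1 + w.im ^ 2)⁻¹ := by
  -- The unit gap `Re w - c ≥ 1` gives `1 + (Im w)² ≤ |w - c|²`.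
  set c := α - 1 with hc
  obtain ⟨m, hm0, hm⟩ := exists_lower_bound_charFunction hK hz hα (c := c) (by linarith) hne
  set B := |a - c| + delayMass b K z.re with hB
  have hB0 : 0 ≤ B := add_nonneg (abs_nonneg _) (delayMass_nonneg hK _)
  refine ⟨B / m, by positivity, fun w hw => ?_⟩
  have hsq : 1 + w.im ^ 2 ≤ ‖w - c‖ ^ 2 := by
    rw [← Complex.normSq_eq_norm_sq, Complex.normSq_apply]
    simp only [Complex.sub_re, Complex.sub_im, Complex.ofReal_re, Complex.ofReal_im, sub_zero]
    have : 1 ≤ w.re - c := by linarith [hw.1]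
    nlinarith
  have hpos : 0 < ‖w - c‖ := by
    refine lt_of_le_of_ne (norm_nonneg _) fun h => ?_
    rw [← h] at hsq
    nlinarith [sq_nonneg w.im]
  have hnum : ‖(w - c) - charFunction a b K w‖ ≤ B := by
    have h1 := norm_charFunction_sub_le (a := a) hK
      (mem_charDomain_of_re_le hK hz (hα.le.trans hw.1))
    have h2 := delayMass_anti hK hz (hα.le.trans hw.1)
    calc _ = ‖((a - c : ℝ) : ℂ) - (charFunction a b K w - (w - a))‖ := by push_cast; ring_nf
      _ ≤ _ := norm_sub_le _ _
      _ ≤ B := by rw [Complex.norm_real, Real.norm_eq_abs, hB]; gcongr; exact h1.trans h2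
  rw [inv_sub_inv (hne w hw) (norm_pos_iff.1 hpos), norm_div, norm_mul]
  calc _ ≤ B / (m * ‖w - c‖ * ‖w - c‖) := by
        gcongr
        exact hm w hw
    _ = B / m * (‖w - c‖ ^ 2)⁻¹ := by field_simp
    _ ≤ _ := by gcongr

namespace IsFundamentalSolution

/-- The inversion formula for the Laplace transform of the fundamental solution, normalised by
subtracting an exponential. -/
lemma sub_exp_eq_integral (hX : IsFundamentalSolution a b K X)
    (hK : IsDelayKernel K) {γ c : ℝ} (hγ : 2 * (|a| + |b|) + 1 < γ)
    (hc : c < γ)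
    (hint : Integrable fun y : ℝ => (charFunction a b K (γ + y * Complex.I))⁻¹ -
      (γ + y * Complex.I - (c : ℂ))⁻¹) {t : ℝ} (ht : 0 ≤ t) :
    ((X t - Real.exp (c * t) : ℝ) : ℂ) = (2 * Real.pi : ℝ)⁻¹ * ∫ y : ℝ,
      Complex.exp ((γ + y * Complex.I) * t) * ((charFunction a b K (γ + y * Complex.I))⁻¹ -
      (γ + y * Complex.I - (c : ℂ))⁻¹) := by
  set γ₀ := 2 * (|a| + |b|) + 1 with hγ₀
  have hγ0 : 0 < γ := lt_trans (by positivity) hγ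
  set G : ℝ → ℂ := fun y => (charFunction a b K (γ + y * Complex.I))⁻¹ -
      (γ + y * Complex.I - (c : ℂ))⁻¹ with hG
  have hXi : ∀ z : ℂ, z.re = γ →
      IntegrableOn (fun t : ℝ => Complex.exp (-z * (t : ℂ)) * (X t : ℂ)) (Ioi 0) := by
    intro z hz
    have h1 := (integrableOn_exp_mul_Ioi (a := γ₀ - γ) (by linarith) 0).const_mul 2
    refine Integrable.mono' h1 (hX.aestronglyMeasurable_transform z).restrict ?_
    refine (ae_restrict_iff' measurableSet_Ioi).2 (ae_of_all _ fun t (ht : 0 < t) => ?_)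
    rw [norm_mul, norm_cexp_neg_mul, Complex.norm_real, Real.norm_eq_abs, hz]
    calc _ ≤ Real.exp (-γ * t) * (2 * Real.exp (γ₀ * t)) := by
          have := hX.exists_exp_bound hK t ht.le
          gcongr
      _ = 2 * (Real.exp (-γ * t) * Real.exp (γ₀ * t)) := by ring
      _ = _ := by rw [← Real.exp_add]; ring_nf
  have hei : ∀ z : ℂ, z.re = γ → IntegrableOn
      (fun t : ℝ => Complex.exp (-z * (t : ℂ)) * (Real.exp (c * t) : ℂ)) (Ioi 0) ∧
      ∫ t in Ioi (0 : ℝ), Complex.exp (-z * (t : ℂ)) * (Real.exp (c * t) : ℂ)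
        = (z - c)⁻¹ := by
    intro z hz
    have h0 : (fun t : ℝ => Complex.exp (-z * (t : ℂ)) * (Real.exp (c * t) : ℂ))
        = fun t : ℝ => Complex.exp ((c - z) * (t : ℂ)) := by
      funext t
      rw [Complex.ofReal_exp, ← Complex.exp_add]; push_cast; ring_nf
    have h1 : ((c : ℂ) - z).re < 0 := by simp [hz]; linarith
    rw [h0]
    refine ⟨integrableOn_exp_mul_complex_Ioi h1 0, ?_⟩
    rw [integral_exp_mul_complex_Ioi h1 0]
    rw [Complex.ofReal_zero, mul_zero, Complex.exp_zero, neg_div, ← div_neg, neg_sub, one_div]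
  -- Subtracting `e^{ct}` cancels the jump of `X` at `0`, so `f` is continuous and inversion holds
  -- pointwise, including at `t = 0`.
  set f : ℝ → ℂ := (Ioi 0).indicator fun t : ℝ =>
    Complex.exp (-(γ : ℂ) * t) * ((X t : ℂ) - (Real.exp (c * t) : ℂ)) with hf
  have hfi : Integrable f := by
    refine (integrable_indicator_iff measurableSet_Ioi).2 ?_
    simp only [mul_sub]
    exact (hXi γ (by simp)).sub (hei γ (by simp)).1
  have hfcont : Continuous f := by
    have h0 : f = fun t : ℝ => Complex.exp (-(γ : ℂ) * (max t 0 : ℝ)) *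
        ((X (max t 0) : ℂ) - (Real.exp (c * max t 0) : ℂ)) := by
      funext t
      rcases le_or_gt t 0 with h | h
      · simp [hf, h, hX.eq_one]
      · simp [hf, h, h.le]
    have h1 : Continuous fun t : ℝ => X (max t 0) :=
      hX.continuousOn.comp_continuous (by fun_prop) fun t => mem_Ici.2 (le_max_right _ _)
    rw [h0]
    have h2 : Continuous fun t : ℝ => Complex.exp (-(γ : ℂ) * (max t 0 : ℝ)) := by fun_prop
    have h3 : Continuous fun t : ℝ => Real.exp (c * max t 0) := by fun_prop
    exact h2.mul ((Complex.continuous_ofReal.comp h1).sub (Complex.continuous_ofReal.comp h3))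
  have hFT : FourierTransform.fourier f = fun ω : ℝ => G (2 * Real.pi * ω) := by
    funext ω
    set z : ℂ := γ + ((2 * Real.pi * ω : ℝ) : ℂ) * Complex.I with hz
    have hzre : z.re = γ := by simp [hz]
    have hlap := hX.charFunction_mul_laplace
      (mem_charDomain_of_nonneg hK (hzre ▸ hγ0.le)) (hXi z hzre)
    have hval : G (2 * Real.pi * ω) = laplace X z - (z - c)⁻¹ := by
      rw [hG, eq_inv_of_mul_eq_one_right hlap]
    rw [hval, ← (hei z hzre).2, laplace, ← integral_sub (hXi z hzre) (hei z hzre).1,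
      Real.fourier_eq', ← integral_indicator measurableSet_Ioi]
    congr 1
    funext t
    by_cases ht : t ∈ Ioi (0 : ℝ)
    · simp only [hf, ht, indicator_of_mem, smul_eq_mul]
      rw [← mul_assoc, ← mul_sub, ← Complex.exp_add]
      congr 2
      simp [hz]
      ring
    · simp [hf, ht]
  have hGi : Integrable (FourierTransform.fourier f) := by
    rw [hFT]
    exact hint.comp_mul_left' (by positivity)
  have hinv := hfi.fourierInv_fourier_eq hGi (hfcont.continuousAt (x := t))
  rw [Real.fourierInv_eq', hFT] at hinv
  have hft : f t = Complex.exp (-(γ : ℂ) * t) * ((X t - Real.exp (c * t) : ℝ) : ℂ) := by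
    rcases ht.eq_or_lt with h | h
    · simp [hf, ← h, hX.eq_one]
    · simp [hf, h]
  have hscale : ∫ ω : ℝ, Complex.exp (((2 * Real.pi * ω : ℝ) : ℂ) * Complex.I * t)
        * G (2 * Real.pi * ω)
      = (2 * Real.pi : ℝ)⁻¹ * ∫ y : ℝ, Complex.exp ((y : ℂ) * Complex.I * t) * G y := by
    rw [Measure.integral_comp_mul_left
      (fun y : ℝ => Complex.exp ((y : ℂ) * Complex.I * t) * G y) (2 * Real.pi),
      abs_of_pos (by positivity), Complex.real_smul, Complex.ofReal_inv]
  have hlhs : ∫ ω : ℝ, Complex.exp (((2 * Real.pi * ω : ℝ) : ℂ) * Complex.I * t)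
        * G (2 * Real.pi * ω) = f t := by
    rw [← hinv]
    congr 1
    funext ω
    rw [smul_eq_mul]
    congr 2
    simp
    ring
  have hexp : Complex.exp ((γ : ℂ) * t) * Complex.exp (-(γ : ℂ) * t) = 1 := by
    rw [← Complex.exp_add]; simp
  calc ((X t - Real.exp (c * t) : ℝ) : ℂ) = Complex.exp ((γ : ℂ) * t) * f t := by
        rw [hft, ← mul_assoc, hexp, one_mul]
    _ = (2 * Real.pi : ℝ)⁻¹ * (Complex.exp ((γ : ℂ) * t) *
          ∫ y : ℝ, Complex.exp ((y : ℂ) * Complex.I * t) * G y) := by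
        rw [← hlhs, hscale]; ring
    _ = _ := by
        rw [← integral_const_mul]
        congr 2
        funext y
        rw [← mul_assoc, ← Complex.exp_add, add_mul]

lemma exists_bound_of_charFunction_ne_zero (hX : IsFundamentalSolution a b K X)
    (hK : IsDelayKernel K) (hz : z ∈ charDomain b K)
    {α : ℝ} (hα : z.re < α) (hne : ∀ w : ℂ, α ≤ w.re → charFunction a b K w ≠ 0) :
    ∃ C, 0 < C ∧ ∀ t, 0 ≤ t → |X t| ≤ C * Real.exp (α * t) := by
  set γ := max α (2 * (|a| + |b|) + 1) + 1 with hγ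
  have hαγ : α < γ := (le_max_left _ _).trans_lt (lt_add_one _)
  have hγ₀ : 2 * (|a| + |b|) + 1 < γ := (le_max_right _ _).trans_lt (lt_add_one _)
  obtain ⟨C, hC0, hC⟩ := exists_bound_inv_charFunction_sub hK hz hα (γ := γ)
    fun w hw => hne w hw.1
  set c := α - 1 with hc
  set G : ℂ → ℂ := fun w => (charFunction a b K w)⁻¹ - (w - (c : ℂ))⁻¹ with hG
  have hGd : ∀ w : ℂ, w.re ∈ Icc α γ → DifferentiableAt ℂ G w := by
    intro w hw
    have h1 := differentiableAt_charFunction (a := a) hK hz (hα.trans_le hw.1)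
    have h2 : w - (c : ℂ) ≠ 0 := by
      refine sub_ne_zero.2 fun h => ?_
      have := hw.1
      rw [h, Complex.ofReal_re] at this
      linarith
    exact (h1.inv (hne w hw.1)).sub ((differentiableAt_id.sub_const _).inv h2)
  have hGi : Integrable fun y : ℝ => G (γ + y * Complex.I) := by
    have hcont : Continuous fun y : ℝ => G (γ + y * Complex.I) := by
      refine continuous_iff_continuousAt.2 fun y => ?_
      refine ContinuousAt.comp (f := fun y : ℝ => (γ + y * Complex.I : ℂ)) (g := G) ?_
        (by fun_prop)
      exact (hGd _ (by simpa using hαγ.le)).continuousAt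
    refine (integrable_inv_one_add_sq.const_mul C).mono' hcont.aestronglyMeasurable
      (ae_of_all _ fun y => ?_)
    simpa using hC (γ + y * Complex.I) (by simpa using hαγ.le)
  have hexp : ∀ (w : ℂ) (t : ℝ), ‖Complex.exp (w * t)‖ = Real.exp (w.re * t) := by
    intro w t
    simp [Complex.norm_exp]
  set J := ∫ y : ℝ, C * (1 + y ^ 2)⁻¹ with hJ
  have hJ0 : 0 ≤ J := integral_nonneg fun y => by positivity
  refine ⟨1 + (2 * Real.pi)⁻¹ * J, by positivity, fun t ht => ?_⟩
  have hrep := hX.sub_exp_eq_integral hK hγ₀ (c := c) (by linarith) hGi ht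
  -- The factor `e^{γt}` only justifies the shift for this fixed `t`; it does not enter the final
  -- estimate.
  have hshift := integral_vertical_eq (F := fun w => Complex.exp (w * t) * G w)
    (C := Real.exp (γ * t) * C) hαγ.le
    (fun w hw => DifferentiableAt.mul (by fun_prop) (hGd w hw))
    (fun w hw => by
      rw [norm_mul, hexp, mul_assoc]
      have h1 := hC w hw
      have h2 := hw.2
      gcongr)
  have hnorm : ‖∫ y : ℝ, Complex.exp ((α + y * Complex.I) * t) * G (α + y * Complex.I)‖
      ≤ Real.exp (α * t) * J := by
    rw [hJ, ← integral_const_mul]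
    refine norm_integral_le_of_norm_le
      ((integrable_inv_one_add_sq.const_mul C).const_mul _) (ae_of_all _ fun y => ?_)
    rw [norm_mul, hexp]
    have h1 := hC (α + y * Complex.I) (by simpa using hαγ.le)
    simp only [Complex.add_im, Complex.ofReal_im, Complex.mul_im, Complex.ofReal_re,
      Complex.I_im, mul_one, Complex.I_re, mul_zero, add_zero, zero_add] at h1
    have h2 : ((α : ℂ) + y * Complex.I).re = α := by simp
    rw [h2]
    gcongr
  have hsub : |X t - Real.exp (c * t)| ≤ (2 * Real.pi)⁻¹ * (Real.exp (α * t) * J) := by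
    have h1 : |X t - Real.exp (c * t)| = ‖((X t - Real.exp (c * t) : ℝ) : ℂ)‖ := by
      rw [Complex.norm_real, Real.norm_eq_abs]
    rw [h1, hrep, norm_mul, Complex.norm_real, Real.norm_of_nonneg (by positivity)]
    refine mul_le_mul_of_nonneg_left ?_ (by positivity)
    exact (congrArg norm hshift.symm).le.trans hnorm
  have hle : Real.exp (c * t) ≤ Real.exp (α * t) := by
    rw [hc]; gcongr; linarith
  have htri : |X t| ≤ |X t - Real.exp (c * t)| + Real.exp (c * t) := by
    simpa using abs_add_le (X t - Real.exp (c * t)) (Real.exp (c * t))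
  calc |X t| ≤ (2 * Real.pi)⁻¹ * (Real.exp (α * t) * J) + Real.exp (α * t) := by linarith
    _ = _ := by ring

end IsFundamentalSolution

end DistributedDelay

end
theorem theorem2p3 (a b : ℝ) (K X : ℝ → ℝ)
    (hK : DistributedDelay.IsDelayKernel K)
    (hX : DistributedDelay.IsFundamentalSolution a b K X) :
    DistributedDelay.alphaZero a b K < ⊤ ∧
    (∀ α : ℝ,
      max (DistributedDelay.alphaZero a b K) (DistributedDelay.abscissa b K) < (α : EReal) →
      ∃ C₁ : ℝ, 0 < C₁ ∧ ∀ t : ℝ, 0 ≤ t → |X t| ≤ C₁ * Real.exp (α * t)) ∧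
    (∀ α₁ : ℝ, (α₁ : EReal) < DistributedDelay.alphaZero a b K →
      ∃ α' : ℝ, α₁ < α' ∧ (α' : EReal) < DistributedDelay.alphaZero a b K ∧
      ∃ U : Set ℝ, U ⊆ Set.Ioi 0 ∧ MeasurableSet U ∧ MeasureTheory.volume U = ⊤ ∧
        ∀ t ∈ U, Real.exp (α' * t) ≤ |X t|) := by
  refine ⟨DistributedDelay.alphaZero_lt_top hK, fun α hα => ?_, fun α₁ hα₁ => ?_⟩
  · obtain ⟨h0, h1⟩ := max_lt_iff.1 hα
    -- A domain point to the left of `α` puts the whole half-plane `Re w ≥ α` in the domain, so a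
    -- zero of `h` there would be a genuine root exceeding `α₀`.
    obtain ⟨z, h2⟩ := iInf_lt_iff.1 h1
    obtain ⟨hz, h3⟩ := iInf_lt_iff.1 h2
    have hzα : z.re < α := by exact_mod_cast h3
    refine hX.exists_bound_of_charFunction_ne_zero hK hz hzα fun w hw hw0 => ?_
    have hmem : w ∈ DistributedDelay.charRoots a b K :=
      ⟨DistributedDelay.mem_charDomain_of_re_le hK hz (hzα.le.trans hw), hw0⟩
    have h4 : ((w.re : ℝ) : EReal) ≤ DistributedDelay.alphaZero a b K :=
      le_iSup₂ (f := fun (z : ℂ) (_ : z ∈ DistributedDelay.charRoots a b K) =>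
        ((z.re : ℝ) : EReal)) w hmem
    have h5 : w.re < α := by exact_mod_cast h4.trans_lt h0
    linarith
  · obtain ⟨z, h1⟩ := lt_iSup_iff.1 hα₁
    obtain ⟨hz, h2⟩ := lt_iSup_iff.1 h1
    have hzα : α₁ < z.re := by exact_mod_cast h2
    -- Choosing `α'` below the real part of an actual root makes it strictly less than `α₀`, whether
    -- or not the supremum is attained.
    obtain ⟨α', h3, h4⟩ := exists_between hzα
    have h5 : ((z.re : ℝ) : EReal) ≤ DistributedDelay.alphaZero a b K :=
      le_iSup₂ (f := fun (z : ℂ) (_ : z ∈ DistributedDelay.charRoots a b K) =>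
        ((z.re : ℝ) : EReal)) z hz
    refine ⟨α', h3, lt_of_lt_of_le (by exact_mod_cast h4) h5,
      {t : ℝ | 0 < t ∧ Real.exp (α' * t) ≤ |X t|}, fun t ht => ht.1, ?_,
      hX.volume_eq_top_of_charRoot hK hz h4, fun t ht => ht.2⟩
    exact (measurableSet_lt measurable_const measurable_id).inter
      (measurableSet_le (by fun_prop) hX.measurable.abs)
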